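/- Setting. Let $\mathcal X$ be a set with at least two elements, $n\ge 1$ and $k\ge 1$ integers. Datasets are elements of $\mathcal X^n$; two datasets are neighbors if they differ in exactly one entry. A query $q:\mathcal X^n\to\mathbb R$ is $1$-sensitive if $|q(\mathbf x)-q(\mathbf x')|\le 1$ for all neighbors $\mathbf x,\mathbf x'$. An analyst asks $k$ $1$-sensitive queries, the $i$-th query $q_i$ being a (measurable) function of the previous answers $a_1,\dots,a_{i-1}$. For a probability measure $\mu$ on $\mathbb R$, the mechanism with i.i.d. noise $\mu$ answers $a_i=q_i(\mathbf x)+\eta_i$ with $\eta_1,\dots,\eta_k$ i.i.d. from $\mu$. It is $(\epsilon,\delta)$-DP if for every analyst, all neighbors $\mathbf x,\mathbf x'$ and every measurable $U\subseteq\mathbb R^k$, $$\Pr[(a_1,\dots,a_k)\in U\mid \mathbf x]\le e^{\epsilon}\Pr[(a_1,\dots,a_k)\in U\mid \mathbf x']+\delta .$$ Call $\mu$ unimodal noise on $[-M,M]$ if $\mu$ is supported on $[-M,M]$ and has a density that is (weakly) decreasing on $[0,\infty)$ and (weakly) increasing on $(-\infty,0]$. Theorem. (i) There is a universal constant $c>0$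 such that, for all $\mathcal X$, $n$, $k$ as above, all $\delta>0$, $M>0$ and all unimodal noise $\mu$ on $[-M,M]$: if the mechanism with i.i.d. noise $\mu$ is $(1,\delta)$-DP, then $M\ge c\,\log(1/\delta)\log k$. (ii) In particular, there is a universal constant $c>0$ such that if $\delta=e^{-k}$ in (i), then $M\ge c\,k\log k$. (iii) For each $k$ let $\mathcal X_k$ be a set with at least two elements, let $n_k\ge1$, $\delta_k>0$, $M_k>0$, and let $\mu_k$ be unimodal noise on $[-M_k,M_k]$ such that, for all large $k$, the mechanism that answers $k$ queries on $\mathcal X_k^{n_k}$ with i.i.d. noise $\mu_k$ is $(1,\delta_k)$-DP. If $\delta_k\le e^{-g(k)}$ for all large $k$, where $g(k)=\omega(k/\log^2k)$, i.e. $g(k)/(k/\log^2 k)\to\infty$, then $M_k=\omega(\sqrt{k\log(1/\delta_k)})$, i.e. $M_k/\sqrt{k\log(1/\delta_k)}\to\infty$ as $k\to\infty$. Consequently no such sequence of mechanisms achieves error $O(\sqrt{k\log(1/\delta_k)})$: for every constant $C$ and all large $k$, it is not the case that for every analyst and every dataset $\max_i|a_i-q_i(\mathbf x)|\le C\sqrt{k\log(1/\delta_k)}$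 holds with probability $1$. -/

import Mathlib

open MeasureTheory Filter Topology

noncomputable section

namespace BoundedNoise

/-- Two datasets `x, x' ∈ Xⁿ` are neighbors if they differ on exactly one entry. -/
def Neighbors {X : Type*} {n : ℕ} (x x' : Fin n → X) : Prop :=
  ∃ i, x i ≠ x' i ∧ ∀ j, j ≠ i → x j = x' j

/-- `q : Xⁿ → ℝ` is a `Δ`-sensitive query. -/
def IsSensitive {X : Type*} {n : ℕ} (Δ : ℝ) (q : (Fin n → X) → ℝ) : Prop :=
  ∀ x x' : Fin n → X, Neighbors x x' → |q x - q x'| ≤ Δ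

/-- A query-asking strategy of an analyst who asks `k` adaptive `Δ`-sensitive queries:
the `i`-th query is a function of the previous answers. For each dataset, the value of the `i`-th
query depends measurably on the previous answers, so that the answers are random variables. -/
structure Analyst (X : Type*) (n k : ℕ) (Δ : ℝ) where
  /-- `query i a` is the `i`-th query that is asked after the answers `a`. -/
  query : (i : Fin k) → (Fin (i : ℕ) → ℝ) → (Fin n → X) → ℝ
  sensitive : ∀ i a, IsSensitive Δ (query i a)
  measurable_query : ∀ i x, Measurable fun a => query i a x

namespace Analyst

variable {X : Type*} {n k : ℕ} {Δ : ℝ}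

/-- The answers `aᵢ = qᵢ(x) + ηᵢ` of the additive-noise mechanism with noise vector `η`, in the
interaction with the analyst `A` on the dataset `x`; here `qᵢ` is determined by `a₀, …, aᵢ₋₁`. -/
def answers (A : Analyst X n k Δ) (x : Fin n → X) (η : Fin k → ℝ) (i : Fin k) : ℝ :=
  A.query i (fun j : Fin (i : ℕ) => A.answers x η ⟨j, j.isLt.trans i.isLt⟩) x + η i
termination_by (i : ℕ)

/-- The true value `qᵢ(x)` of the `i`-th query asked in that interaction. -/
def trueValue (A : Analyst X n k Δ) (x : Fin n → X) (η : Fin k → ℝ) (i : Fin k) : ℝ :=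
  A.query i (fun j : Fin (i : ℕ) => A.answers x η ⟨j, j.isLt.trans i.isLt⟩) x

end Analyst

/-- The mechanism that adds to the answer to each of `k` adaptive `Δ`-sensitive queries on
datasets in `Xⁿ` an i.i.d. noise drawn from `μ` is `(ε, δ)`-differentially private. -/
def IsDP (X : Type*) (n k : ℕ) (Δ ε δ : ℝ) (μ : Measure ℝ) : Prop :=
  ∀ (A : Analyst X n k Δ) (x x' : Fin n → X), Neighbors x x' →
    ∀ U : Set (Fin k → ℝ), MeasurableSet U →
      Measure.pi (fun _ : Fin k => μ) {η | A.answers x η ∈ U} ≤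
        ENNReal.ofReal (Real.exp ε) *
            Measure.pi (fun _ : Fin k => μ) {η | A.answers x' η ∈ U} +
          ENNReal.ofReal δ

/-- The mechanism that adds i.i.d. noise drawn from `μ` has, with probability one, error
`maxᵢ |aᵢ - qᵢ(x)|` at most `α`, whatever the dataset and the analyst. -/
def HasErrorAtMost (X : Type*) (n k : ℕ) (Δ α : ℝ) (μ : Measure ℝ) : Prop :=
  ∀ (A : Analyst X n k Δ) (x : Fin n → X),
    ∀ᵐ η ∂Measure.pi (fun _ : Fin k => μ), ∀ i, |A.answers x η i - A.trueValue x η i| ≤ α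

/-- `μ` is supported on `[-M, M]` and has a density that is decreasing on `[0, ∞)` and increasing
on `(-∞, 0]` (both in the weak sense). -/
structure IsUnimodalNoise (M : ℝ) (μ : Measure ℝ) : Prop where
  support : μ (Set.Icc (-M) M)ᶜ = 0
  density : ∃ p : ℝ → ENNReal, Measurable p ∧ μ = volume.withDensity p ∧
    AntitoneOn p (Set.Ici 0) ∧ MonotoneOn p (Set.Iic 0)

end BoundedNoise

end

open MeasureTheory Filter Topology

namespace BoundedNoise

/-! Let p(t) be the noise mass above t. Queries that all drop by 1 between two neighbors, tested on
the event that the first m answers exceed t, give p(t)^m ≤ e p(t+1)^m + δ for every m ≤ k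
(`IsDP.tail_pow_le`).

Put a = log(1/δ)/2 and suppose p(t) ≥ exp(-u) with a/k ≤ u ≤ a. For m ≈ a/u the left side is at
least √δ, so δ is negligible and taking m-th roots gives p(t+1) ≥ exp(-(u + 2/m)), where u + 2/m ≤
(1 + 4/a)u. A unit step thus multiplies the exponent by at most exp(4/a). The tail is 1 left of -M
and 0 from M on, so the exponent must climb from a/k past a, which takes at least (a/4) log k steps,
while about 2M are available. -/

/-- The analyst whose queries all have value `0` on `x` and `-1` elsewhere. -/
noncomputable def distinguisher {X : Type*} {n : ℕ} (k : ℕ) (x : Fin n → X) : Analyst X n k 1 where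
  query _ _ y := by classical exact if y = x then 0 else -1
  sensitive i a y y' _ := by
    dsimp only
    split_ifs <;> norm_num
  measurable_query i y := measurable_const

lemma answers_distinguisher_self {X : Type*} {n k : ℕ} (x : Fin n → X) (η : Fin k → ℝ) :
    (distinguisher k x).answers x η = η := by
  funext i
  rw [Analyst.answers]
  simp [distinguisher]

lemma answers_distinguisher_of_ne {X : Type*} {n k : ℕ} {x y : Fin n → X} (h : y ≠ x)
    (η : Fin k → ℝ) (i : Fin k) : (distinguisher k x).answers y η i = η i - 1 := by
  rw [Analyst.answers]
  simp [distinguisher, h]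
  ring

lemma exists_neighbors (X : Type*) [Nontrivial X] {n : ℕ} (hn : 0 < n) :
    ∃ x x' : Fin n → X, Neighbors x x' := by
  obtain ⟨a, b, hab⟩ := exists_pair_ne X
  refine ⟨fun _ => a, Function.update (fun _ => a) ⟨0, hn⟩ b, ⟨0, hn⟩, by simpa using hab, ?_⟩
  intro j hj
  simp [hj]

lemma pi_forall_lt_mem (μ : Measure ℝ) [IsProbabilityMeasure μ] {m k : ℕ} (hm : m ≤ k) (s : Set ℝ) :
    Measure.pi (fun _ : Fin k => μ) {η | ∀ i : Fin k, (i : ℕ) < m → η i ∈ s} = μ s ^ m := by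
  have hset : {η : Fin k → ℝ | ∀ i : Fin k, (i : ℕ) < m → η i ∈ s} =
      Set.pi Set.univ (fun i : Fin k => if (i : ℕ) < m then s else Set.univ) := by
    ext η
    simp only [Set.mem_ofPred_eq, Set.mem_pi, Set.mem_univ, true_imp_iff]
    refine forall_congr' fun i => ?_
    split_ifs with h <;> simp [h]
  rw [hset, Measure.pi_pi]
  have : ∀ i : Fin k, μ (if (i : ℕ) < m then s else Set.univ) = if (i : ℕ) < m then μ s else 1 := by
    intro i
    split_ifs <;> simp
  simp_rw [this]
  rw [Fin.prod_univ_eq_prod_range (fun i => if i < m then μ s else 1) k, Finset.prod_ite,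
    Finset.prod_const, Finset.prod_const_one, mul_one]
  congr 1
  rw [show (Finset.range k).filter (fun i => i < m) = Finset.range m by
    ext i; simp; omega]
  simp

/-- Privacy of the first `m` answers, tested on the event that all of them exceed `t`. -/
lemma IsDP.tail_pow_le {X : Type*} [Nontrivial X] {n k : ℕ} {δ : ℝ} {μ : Measure ℝ}
    [IsProbabilityMeasure μ] (hn : 0 < n) (hδ : 0 ≤ δ) (h : IsDP X n k 1 1 δ μ) {m : ℕ}
    (hm : m ≤ k) (t : ℝ) :
    μ.real (Set.Ioi t) ^ m ≤ Real.exp 1 * μ.real (Set.Ioi (t + 1)) ^ m + δ := by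
  obtain ⟨x, x', hxx⟩ := exists_neighbors X hn
  have hne : x' ≠ x := by
    rintro rfl
    obtain ⟨i, hi, -⟩ := hxx
    exact hi rfl
  have hU : MeasurableSet {η : Fin k → ℝ | ∀ i : Fin k, (i : ℕ) < m → η i ∈ Set.Ioi t} := by
    simp only [Set.ofPred_forall]
    exact MeasurableSet.iInter fun i => MeasurableSet.iInter fun _ =>
      measurable_pi_apply i measurableSet_Ioi
  have key := h (distinguisher k x) x x' hxx _ hU
  have e1 : {η : Fin k → ℝ | (distinguisher k x).answers x η ∈
      {η : Fin k → ℝ | ∀ i : Fin k, (i : ℕ) < m → η i ∈ Set.Ioi t}} =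
      {η : Fin k → ℝ | ∀ i : Fin k, (i : ℕ) < m → η i ∈ Set.Ioi t} := by
    simp only [answers_distinguisher_self, Set.mem_ofPred_eq]
  have e2 : {η : Fin k → ℝ | (distinguisher k x).answers x' η ∈
      {η : Fin k → ℝ | ∀ i : Fin k, (i : ℕ) < m → η i ∈ Set.Ioi t}} =
      {η : Fin k → ℝ | ∀ i : Fin k, (i : ℕ) < m → η i ∈ Set.Ioi (t + 1)} := by
    simp only [answers_distinguisher_of_ne hne, Set.mem_ofPred_eq, Set.mem_Ioi, lt_sub_iff_add_lt]
  rw [e1, e2, pi_forall_lt_mem μ hm, pi_forall_lt_mem μ hm, ← ofReal_measureReal, ← ofReal_measureReal,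
    ← ENNReal.ofReal_pow measureReal_nonneg, ← ENNReal.ofReal_pow measureReal_nonneg,
    ← ENNReal.ofReal_mul (Real.exp_pos 1).le, ← ENNReal.ofReal_add (by positivity) hδ] at key
  exact (ENNReal.ofReal_le_ofReal_iff (by positivity)).1 key

lemma tail_eq_one {μ : Measure ℝ} [IsProbabilityMeasure μ] {M t : ℝ}
    (h : μ (Set.Icc (-M) M)ᶜ = 0) (ht : t < -M) : μ.real (Set.Ioi t) = 1 := by
  have h0 : μ (Set.Ioi t)ᶜ = 0 :=
    measure_mono_null (Set.compl_subset_compl.2 fun y hy => ht.trans_le hy.1) h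
  rw [measureReal_def, (prob_compl_eq_zero_iff measurableSet_Ioi).1 h0, ENNReal.toReal_one]

lemma tail_eq_zero {μ : Measure ℝ} {M t : ℝ}
    (h : μ (Set.Icc (-M) M)ᶜ = 0) (ht : M ≤ t) : μ.real (Set.Ioi t) = 0 := by
  have h0 : μ (Set.Ioi t) = 0 :=
    measure_mono_null (show Set.Ioi t ⊆ (Set.Icc (-M) M)ᶜ from
      fun y (hy : t < y) hy' => (ht.trans_lt hy).not_ge hy'.2) h
  rw [measureReal_def, h0, ENNReal.toReal_zero]

/-! ### Growth of the tail exponent -/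

/-- Take m = ⌊a/u⌋: u ≥ a/k keeps m ≤ k, and u ≤ a makes a/u ≥ 1, so rounding down loses at most a
factor 2. -/
lemma exists_nat_floor_div {a u : ℝ} {k : ℕ} (hk : 0 < k) (hu : 0 < u) (h1 : a / k ≤ u)
    (h2 : u ≤ a) : ∃ m : ℕ, 0 < m ∧ m ≤ k ∧ m * u ≤ a ∧ 1 / (m : ℝ) ≤ 2 * u / a := by
  have ha : 0 < a := hu.trans_le h2
  have hk' : (0 : ℝ) < k := Nat.cast_pos.2 hk
  have h1' : 1 ≤ a / u := by rwa [le_div_iff₀ hu, one_mul]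
  have hm0 : 0 < ⌊a / u⌋₊ := Nat.floor_pos.2 h1'
  have hmR : (1 : ℝ) ≤ (⌊a / u⌋₊ : ℝ) := by exact_mod_cast hm0
  refine ⟨⌊a / u⌋₊, hm0, ?_, ?_, ?_⟩
  · refine Nat.floor_le_of_le ?_
    rw [div_le_iff₀ hu]
    rwa [div_le_iff₀ hk', mul_comm] at h1
  · rw [← le_div_iff₀ hu]
    exact Nat.floor_le (by positivity)
  · have h3 : a / u < ⌊a / u⌋₊ + 1 := Nat.lt_floor_add_one _
    rw [div_lt_iff₀ hu] at h3
    rw [div_le_div_iff₀ (by linarith) ha]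
    nlinarith

lemma exp_neg_div_le_of_exp_neg_le_pow {p b : ℝ} {m : ℕ} (hm : 0 < m) (hp : 0 ≤ p)
    (h : Real.exp (-b) ≤ p ^ m) : Real.exp (-(b * (1 / m))) ≤ p := by
  have hm' : (m : ℝ) ≠ 0 := Nat.cast_ne_zero.2 hm.ne'
  refine le_of_pow_le_pow_left₀ hm.ne' hp ?_
  rwa [← Real.exp_nat_mul, show (m : ℝ) * -(b * (1 / m)) = -b by field_simp]

/-- If the exponent `u` of the lower bound `exp (-u)` on `p i` grows at most by the factor `R` in
each step, as long as it lies in `[a / k, a]`, then `p` cannot vanish before step `log k / log R`. -/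
lemma lt_pow_of_exp_neg_growth {p : ℕ → ℝ} {a R : ℝ} {k I : ℕ} (hk : 0 < k) (ha : 0 < a)
    (hR : 1 ≤ R) (h0 : p 0 = 1) (hI : p I = 0)
    (hstep : ∀ i u, a / k ≤ u → u ≤ a → Real.exp (-u) ≤ p i → Real.exp (-(R * u)) ≤ p (i + 1)) :
    (k : ℝ) < R ^ I := by
  by_contra! hcon
  have hk' : (0 : ℝ) < k := Nat.cast_pos.2 hk
  have main : ∀ i, i ≤ I → Real.exp (-(a / k * R ^ i)) ≤ p i := by
    intro i
    induction i with
    | zero =>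
      intro _
      -- As p 0 = 1, any positive exponent may start; a/k is the least one to which `hstep` applies.
      rw [h0, Real.exp_le_one_iff]
      have : 0 < a / k := by positivity
      simp only [pow_zero, mul_one]
      linarith
    | succ i ih =>
      intro hi
      have := hstep i (a / k * R ^ i) (le_mul_of_one_le_right (by positivity) (one_le_pow₀ hR)) ?_
        (ih (by omega))
      · rwa [show a / k * R ^ (i + 1) = R * (a / k * R ^ i) by ring]
      · have h1 : R ^ i ≤ k := (pow_le_pow_right₀ hR (by omega)).trans hcon
        calc a / k * R ^ i ≤ a / k * k := by gcongr
          _ = a := by field_simp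
  have := main I le_rfl
  rw [hI] at this
  exact (Real.exp_pos _).not_ge this

lemma growth_of_small_delta {p p' δ a u : ℝ} {k : ℕ} (hk : 0 < k) (hp' : 0 ≤ p')
    (ha : Real.log 2 ≤ a) (hδ : δ = Real.exp (-(2 * a)))
    (h : ∀ m ≤ k, p ^ m ≤ Real.exp 1 * p' ^ m + δ) (h1 : a / k ≤ u) (h2 : u ≤ a)
    (hu : Real.exp (-u) ≤ p) : Real.exp (-(Real.exp (4 / a) * u)) ≤ p' := by
  have ha0 : 0 < a := (Real.log_pos one_lt_two).trans_le ha
  have hu0 : 0 < u := (div_pos ha0 (Nat.cast_pos.2 hk)).trans_le h1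
  obtain ⟨m, hm0, hmk, hmu, hm⟩ := exists_nat_floor_div hk hu0 h1 h2
  have hm' : (0 : ℝ) < m := Nat.cast_pos.2 hm0
  have e1 : Real.exp (-(m * u)) ≤ p ^ m := by
    have := pow_le_pow_left₀ (Real.exp_pos _).le hu m
    rwa [← Real.exp_nat_mul, mul_neg] at this
  -- δ is exp(-a) squared: one factor is at most 1/2, the other at most exp(-mu).
  have e2 : δ ≤ Real.exp (-(m * u)) / 2 := by
    have : Real.exp (-a) ≤ 1 / 2 := by
      calc Real.exp (-a) ≤ Real.exp (-Real.log 2) := Real.exp_le_exp.2 (by linarith)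
        _ = 1 / 2 := by rw [Real.exp_neg, Real.exp_log two_pos, one_div]
    have h3 : Real.exp (-a) ≤ Real.exp (-(m * u)) := Real.exp_le_exp.2 (by linarith)
    rw [hδ, show -(2 * a) = -a + -a by ring, Real.exp_add]
    nlinarith [Real.exp_pos (-a)]
  have e3 : Real.exp (-(m * u + 2)) ≤ p' ^ m := by
    have h4 := h m hmk
    have h5 : Real.exp (-(m * u)) ≤ 2 * (Real.exp 1 * p' ^ m) := by linarith
    have h6 : 2 * Real.exp 1 ≤ Real.exp 2 := by
      rw [show (2 : ℝ) = 1 + 1 by norm_num, Real.exp_add]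
      have := Real.add_one_le_exp (1 : ℝ)
      nlinarith [Real.exp_pos 1]
    rw [neg_add, Real.exp_add, Real.exp_neg 2, ← div_eq_mul_inv, div_le_iff₀ (Real.exp_pos 2)]
    have : 0 ≤ p' ^ m := by positivity
    nlinarith
  refine le_trans (Real.exp_le_exp.2 (neg_le_neg ?_))
    (exp_neg_div_le_of_exp_neg_le_pow hm0 hp' e3)
  calc (m * u + 2) * (1 / (m : ℝ)) = u + 2 * (1 / m) := by field_simp
    _ ≤ u + 2 * (2 * u / a) := by gcongr
    _ = (4 / a + 1) * u := by field_simp; ring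
    _ ≤ Real.exp (4 / a) * u := by gcongr; exact Real.add_one_le_exp _

/-- For δ = 1 - τ near 1, keeping mu ≤ τ/2 gives p^m ≥ 1 - τ/2, so τ/2 survives the subtraction of
δ. The growth factor is cruder, but only its logarithm matters. -/
lemma growth_of_lt_one {p p' τ u : ℝ} {k : ℕ} (hk : 0 < k) (hp' : 0 ≤ p') (hτ : 0 < τ)
    (h : ∀ m ≤ k, p ^ m ≤ Real.exp 1 * p' ^ m + (1 - τ)) (h1 : τ / 2 / k ≤ u) (h2 : u ≤ τ / 2)
    (hu : Real.exp (-u) ≤ p) : Real.exp (-(8 / τ ^ 2 * u)) ≤ p' := by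
  have hu0 : 0 < u := (div_pos (half_pos hτ) (Nat.cast_pos.2 hk)).trans_le h1
  obtain ⟨m, hm0, hmk, hmu, hm⟩ := exists_nat_floor_div hk hu0 h1 h2
  have e1 : 1 - τ / 2 ≤ p ^ m := by
    have h3 := pow_le_pow_left₀ (Real.exp_pos _).le hu m
    rw [← Real.exp_nat_mul] at h3
    have h4 := Real.add_one_le_exp ((m : ℝ) * -u)
    linarith
  have h4 := h m hmk
  have e3 : Real.exp (-(2 / τ)) ≤ p' ^ m := by
    have h5 : τ / 2 ≤ Real.exp 1 * p' ^ m := by linarith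
    have h6 := Real.add_one_le_exp (2 / τ - 1)
    rw [sub_add_cancel] at h6
    rw [Real.exp_neg, inv_le_iff_one_le_mul₀ (Real.exp_pos _),
      show Real.exp (2 / τ) = Real.exp (2 / τ - 1) * Real.exp 1 by rw [← Real.exp_add]; ring_nf]
    calc (1 : ℝ) = 2 / τ * (τ / 2) := by field_simp
      _ ≤ Real.exp (2 / τ - 1) * (Real.exp 1 * p' ^ m) := by gcongr
      _ = _ := by ring
  refine le_trans (Real.exp_le_exp.2 (neg_le_neg ?_))
    (exp_neg_div_le_of_exp_neg_le_pow hm0 hp' e3)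
  calc 2 / τ * (1 / (m : ℝ)) ≤ 2 / τ * (2 * u / (τ / 2)) := by gcongr
    _ = 8 / τ ^ 2 * u := by field_simp; ring

/-- For δ > 1/4, log(1/δ) is at most 4τ with τ = 1 - δ, which cancels the 8/τ bounding the logarithm
of the growth factor. -/
lemma log_mul_log_le_of_tail {p : ℕ → ℝ} {δ : ℝ} {k I : ℕ} (hk : 0 < k) (hδ : 0 < δ)
    (hδ1 : δ < 1) (hp : ∀ i, 0 ≤ p i) (h0 : p 0 = 1) (hI : p I = 0)
    (h : ∀ i, ∀ m ≤ k, p i ^ m ≤ Real.exp 1 * p (i + 1) ^ m + δ) :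
    Real.log (1 / δ) * Real.log k ≤ 32 * I := by
  have hk' : (0 : ℝ) < k := Nat.cast_pos.2 hk
  have hL : Real.log (1 / δ) = -Real.log δ := by rw [one_div, Real.log_inv]
  have hL0 : 0 < Real.log (1 / δ) := by rw [hL]; linarith [Real.log_neg hδ hδ1]
  rcases le_or_gt δ (1 / 4) with hs | hs
  · set a := Real.log (1 / δ) / 2 with ha
    have ha2 : Real.log 2 ≤ a := by
      have : Real.log 4 ≤ Real.log (1 / δ) :=
        Real.log_le_log (by norm_num) (by rw [le_div_iff₀ hδ]; linarith)
      rw [show (4 : ℝ) = 2 ^ 2 by norm_num, Real.log_pow] at this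
      push_cast at this
      linarith
    have ha0 : 0 < a := by positivity
    have hlt := lt_pow_of_exp_neg_growth (R := Real.exp (4 / a)) hk ha0
      (Real.one_le_exp (by positivity)) h0 hI fun i u h1 h2 h3 =>
        growth_of_small_delta hk (hp _) ha2
          (by rw [ha, hL, show -(2 * (-Real.log δ / 2)) = Real.log δ by ring, Real.exp_log hδ])
          (h i) h1 h2 h3
    have hlog := (Real.log_lt_log hk' hlt).le
    rw [Real.log_pow, Real.log_exp] at hlog
    have : Real.log (1 / δ) * Real.log k ≤ Real.log (1 / δ) * (I * (4 / a)) := by gcongr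
    have e : Real.log (1 / δ) * (I * (4 / a)) = 8 * I := by
      rw [show Real.log (1 / δ) = 2 * a by rw [ha]; ring]
      field_simp
      ring
    have : (0 : ℝ) ≤ I := Nat.cast_nonneg _
    linarith
  · set τ := 1 - δ with hτ
    have hτ0 : 0 < τ := by linarith
    have hlt := lt_pow_of_exp_neg_growth (R := 8 / τ ^ 2) hk (half_pos hτ0)
      (by rw [le_div_iff₀ (by positivity)]; nlinarith) h0 hI fun i u h1 h2 h3 =>
        growth_of_lt_one hk (hp _) hτ0 (by simpa [hτ] using h i) h1 h2 h3
    have hlog := (Real.log_lt_log hk' hlt).le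
    rw [Real.log_pow] at hlog
    have hLτ : Real.log (1 / δ) ≤ 4 * τ := by
      have h1 := Real.log_le_sub_one_of_pos (show 0 < 1 / δ by positivity)
      have h2 : 1 / δ - 1 = τ / δ := by rw [hτ]; field_simp
      have h3 : τ / δ ≤ 4 * τ := by rw [div_le_iff₀ hδ]; nlinarith
      linarith
    have hB : Real.log (8 / τ ^ 2) ≤ 8 / τ := by
      have h1 : Real.log (8 / τ ^ 2) ≤ Real.log ((4 / τ) ^ 2) :=
        Real.log_le_log (by positivity) (by rw [div_pow]; gcongr; norm_num)
      rw [Real.log_pow] at h1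
      have h2 := Real.log_le_sub_one_of_pos (show 0 < 4 / τ by positivity)
      push_cast at h1
      have : 8 / τ = 2 * (4 / τ) := by ring
      linarith
    have hI0 : (0 : ℝ) ≤ I := Nat.cast_nonneg _
    have hlk : 0 ≤ Real.log k := Real.log_natCast_nonneg k
    calc Real.log (1 / δ) * Real.log k ≤ 4 * τ * (I * (8 / τ)) := by
          gcongr
          exact hlog.trans (by gcongr)
      _ = 32 * I := by field_simp; ring

/-! ### The lower bound on M -/

/-- Any i.i.d. noise supported on `[-M, M]` that yields privacy satisfies the lower bound on `M`;
unimodality is not needed. -/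
theorem IsDP.log_mul_log_le {X : Type*} [Nontrivial X] {n k : ℕ} {δ M : ℝ} {μ : Measure ℝ}
    [IsProbabilityMeasure μ] (hn : 0 < n) (hk : 0 < k) (hδ : 0 < δ) (hM : 0 < M)
    (hμ : μ (Set.Icc (-M) M)ᶜ = 0) (h : IsDP X n k 1 1 δ μ) :
    1 / 192 * (Real.log (1 / δ) * Real.log k) ≤ M := by
  rcases le_or_gt 1 δ with h1 | h1
  · have h2 : Real.log (1 / δ) ≤ 0 := by
      rw [one_div, Real.log_inv]
      linarith [Real.log_nonneg h1]
    have := mul_nonpos_of_nonpos_of_nonneg h2 (Real.log_natCast_nonneg k)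
    linarith
  -- This absorbs rounding: the step count is below 2M + 2, and 32(2M + 2) ≤ 192M once M ≥ 1/2.
  have hM2 : 1 / 2 ≤ M := by
    by_contra! hlt
    have := h.tail_pow_le hn hδ.le hk (-1 / 2)
    rw [tail_eq_one hμ (by linarith), tail_eq_zero hμ (by linarith)] at this
    norm_num at this
    linarith
  -- The start lies strictly left of -M, as `tail_eq_one` requires.
  have key := log_mul_log_le_of_tail (p := fun i : ℕ => μ.real (Set.Ioi (-M - 1 + i)))
    (I := ⌈2 * M + 1⌉₊) hk hδ h1 (fun _ => measureReal_nonneg)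
    (tail_eq_one hμ (by simp)) (tail_eq_zero hμ (by linarith [Nat.le_ceil (2 * M + 1)]))
    (fun i m hm => by
      have := h.tail_pow_le hn hδ.le hm (-M - 1 + i)
      simpa [add_assoc] using this)
  have := Nat.ceil_lt_add_one (show 0 ≤ 2 * M + 1 by linarith)
  linarith

/-! ### Error bounds and asymptotics -/

/-- The error of an answer is exactly its noise, so an error bound is a support bound and can
replace M in the lower bound. -/
lemma HasErrorAtMost.support {X : Type*} [Nonempty X] {n k : ℕ} {α : ℝ} {μ : Measure ℝ}
    [IsProbabilityMeasure μ] (hk : 0 < k) (h : HasErrorAtMost X n k 1 α μ) :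
    μ (Set.Icc (-α) α)ᶜ = 0 := by
  obtain ⟨x⟩ : Nonempty (Fin n → X) := inferInstance
  have h1 := h (distinguisher k x) x
  have h2 : ∀ᵐ η ∂Measure.pi (fun _ : Fin k => μ), η ⟨0, hk⟩ ∈ Set.Icc (-α) α := by
    filter_upwards [h1] with η hη
    have := hη ⟨0, hk⟩
    rw [Analyst.answers, Analyst.trueValue, add_sub_cancel_left] at this
    exact abs_le.1 this
  have h3 := (measurePreserving_eval (fun _ : Fin k => μ) ⟨0, hk⟩).measure_preimage
    (measurableSet_Icc (a := -α) (b := α)).compl.nullMeasurableSet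
  rw [← h3]
  exact h2

lemma tendsto_atTop_of_mul_sqrt_le {f r : ℕ → ℝ} (hr : Tendsto r atTop atTop) {c : ℝ} (hc : 0 < c)
    (h : ∀ᶠ n in atTop, c * Real.sqrt (r n) ≤ f n) : Tendsto f atTop atTop :=
  tendsto_atTop_mono' _ h ((Real.tendsto_sqrt_atTop.comp hr).const_mul_atTop hc)

lemma sqrt_le_div_sqrt {c M L g : ℝ} {k : ℕ} (hk : 1 < k) (hL : 0 < L)
    (hg : g ≤ L) (h : c * (L * Real.log k) ≤ M) (hc : 0 ≤ c) :
    c * Real.sqrt (g / (k / Real.log k ^ 2)) ≤ M / Real.sqrt (k * L) := by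
  have hk' : (0 : ℝ) < k := Nat.cast_pos.2 (by omega)
  have hl : 0 < Real.log k := Real.log_pos (by exact_mod_cast hk)
  have hs : 0 < Real.sqrt (k * L) := Real.sqrt_pos.2 (by positivity)
  rw [le_div_iff₀ hs]
  refine le_trans ?_ h
  rw [mul_assoc, ← Real.sqrt_mul' _ (by positivity)]
  gcongr
  rw [Real.sqrt_le_left (by positivity)]
  calc g / (k / Real.log k ^ 2) * (k * L) = g * L * Real.log k ^ 2 := by field_simp
    _ ≤ L * L * Real.log k ^ 2 := by gcongr
    _ = _ := by ring

end BoundedNoise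

theorem theorem3 :
    (∃ c : ℝ, 0 < c ∧
      ∀ (X : Type*) [Nontrivial X] (n k : ℕ) (δ M : ℝ) (μ : Measure ℝ) [IsProbabilityMeasure μ],
        0 < n → 0 < k → 0 < δ → 0 < M →
        BoundedNoise.IsUnimodalNoise M μ → BoundedNoise.IsDP X n k 1 1 δ μ →
        c * (Real.log (1 / δ) * Real.log k) ≤ M) ∧
    (∃ c : ℝ, 0 < c ∧
      ∀ (X : Type*) [Nontrivial X] (n k : ℕ) (M : ℝ) (μ : Measure ℝ) [IsProbabilityMeasure μ],
        0 < n → 0 < k → 0 < M →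
        BoundedNoise.IsUnimodalNoise M μ → BoundedNoise.IsDP X n k 1 1 (Real.exp (-k)) μ →
        c * (k * Real.log k) ≤ M) ∧
    (∀ (X : ℕ → Type*) [∀ k, Nontrivial (X k)] (n : ℕ → ℕ) (δ M g : ℕ → ℝ)
        (μ : ℕ → Measure ℝ) [∀ k, IsProbabilityMeasure (μ k)],
      (∀ᶠ k in atTop, 0 < n k ∧ 0 < δ k ∧ 0 < M k ∧
        BoundedNoise.IsUnimodalNoise (M k) (μ k) ∧
        BoundedNoise.IsDP (X k) (n k) k 1 1 (δ k) (μ k)) →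
      (∀ᶠ k in atTop, δ k ≤ Real.exp (-g k)) →
      Tendsto (fun k : ℕ => g k / (k / Real.log k ^ 2)) atTop atTop →
      Tendsto (fun k : ℕ => M k / Real.sqrt (k * Real.log (1 / δ k))) atTop atTop ∧
      ∀ C : ℝ, ∀ᶠ k : ℕ in atTop,
        ¬ BoundedNoise.HasErrorAtMost (X k) (n k) k 1
            (C * Real.sqrt (k * Real.log (1 / δ k))) (μ k)) := by
  refine ⟨⟨1 / 192, by norm_num, fun X _ n k δ M μ _ hn hk hδ hM hμ h =>
    h.log_mul_log_le hn hk hδ hM hμ.support⟩, ⟨1 / 192, by norm_num,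
    fun X _ n k M μ _ hn hk hM hμ h => ?_⟩, ?_⟩
  · have := h.log_mul_log_le hn hk (Real.exp_pos _) hM hμ.support
    rwa [one_div (Real.exp _), Real.log_inv, Real.log_exp, neg_neg] at this
  · intro X _ n δ M g μ _ hmech hδg hg
    have hLg : ∀ᶠ k : ℕ in atTop, 1 < k ∧ 0 < Real.log (1 / δ k) ∧ g k ≤ Real.log (1 / δ k) := by
      filter_upwards [hmech, hδg, hg.eventually_gt_atTop 0, eventually_gt_atTop 1]
        with k hk hδ hpos h1
      have hgL : g k ≤ Real.log (1 / δ k) := by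
        have := Real.log_le_log hk.2.1 hδ
        rw [Real.log_exp] at this
        rw [one_div, Real.log_inv]
        linarith
      have hl : 0 < Real.log k := Real.log_pos (by exact_mod_cast h1)
      have hk' : (0 : ℝ) < k := Nat.cast_pos.2 (by omega)
      exact ⟨h1, ((div_pos_iff_of_pos_right (by positivity)).1 hpos).trans_le hgL, hgL⟩
    refine ⟨BoundedNoise.tendsto_atTop_of_mul_sqrt_le hg (c := 1 / 192) (by norm_num) ?_, fun C => ?_⟩
    · filter_upwards [hmech, hLg] with k ⟨hn, hδ, hM, hμ, h⟩ ⟨h1, hL, hgL⟩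
      exact BoundedNoise.sqrt_le_div_sqrt h1 hL hgL
        (h.log_mul_log_le hn (by omega) hδ hM hμ.support) (by norm_num)
    · have hbig := ((Real.tendsto_sqrt_atTop.comp hg).const_mul_atTop
        (show (0 : ℝ) < 1 / 192 by norm_num)).eventually_gt_atTop (max C 1)
      filter_upwards [hmech, hLg, hbig] with k ⟨hn, hδ, hM, hμ, h⟩ ⟨h1, hL, hgL⟩ hlt herr
      have hs : 0 < Real.sqrt (k * Real.log (1 / δ k)) :=
        Real.sqrt_pos.2 (mul_pos (Nat.cast_pos.2 (by omega)) hL)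
      -- C may be nonpositive, while the lower bound needs a positive radius; hence `max C 1`.
      have hle : C * Real.sqrt (k * Real.log (1 / δ k)) ≤
          max C 1 * Real.sqrt (k * Real.log (1 / δ k)) := by
        gcongr
        exact le_max_left _ _
      have hsupp := measure_mono_null
        (Set.compl_subset_compl.2 (Set.Icc_subset_Icc (neg_le_neg hle) hle))
        (herr.support (by omega))
      have := BoundedNoise.sqrt_le_div_sqrt h1 hL hgL
        (h.log_mul_log_le hn (by omega) hδ (mul_pos (by positivity) hs) hsupp) (by norm_num)
      rw [mul_div_assoc, div_self hs.ne', mul_one] at this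
      exact this.not_gt hlt
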